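/- Let $U=\{z\in\mathbb C:|z|<1\}$ and $D_r=\{w\in\mathbb C:|w|<r\}$. Let $f(z)=z+\sum_{n\ge 2}a_nz^n$ be analytic and univalent in $U$, let $g=f^{-1}:f(U)\to U$ be its inverse, and let $r_0\ge 1/4$ be such that $D_{r_0}\subseteq f(U)$; thus $g$ is analytic and univalent in $D_{r_0}$ and $f(g(w))=w$ there. Put $$G(z)=\frac{1}{1-\sqrt2\,z+z^2},\qquad z\in U .$$ Suppose that $f\in\mathfrak R_\Sigma(G)$, that is, $$f'(z)\prec G(z)\quad (z\in U)\qquad\text{and}\qquad g'(w)\prec G(w)\quad (w\in D_{r_0}),$$ where $F\prec G$ on a disk $D_r$ means that there is an analytic function $\omega$ on $D_r$ with $\omega(0)=0$, $|\omega|<1$ and $F=G\circ\omega$ on $D_r$. Then $$|a_2a_4-a_3^2|\le \frac14 .$$ -/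

import Mathlib

open Metric

namespace BiUnivalent

/-- The open unit disk `U` of the complex plane. -/
def unitDisk : Set ℂ := ball (0 : ℂ) 1

/-- The class `A`: functions analytic in `U` of the form `f(z) = z + a₂ z² + a₃ z³ + ⋯`.
Values outside `U` play no role. -/
def classA : Set (ℂ → ℂ) :=
  {f | AnalyticOnNhd ℂ f unitDisk ∧ f 0 = 0 ∧ deriv f 0 = 1}

/-- The class `S` of all functions in `A` that are univalent (injective) in `U`. -/
def classS : Set (ℂ → ℂ) :=
  {f | f ∈ classA ∧ Set.InjOn f unitDisk}

/-- The `n`-th Taylor coefficient `aₙ` of `f` at the origin. -/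
noncomputable def coeff (f : ℂ → ℂ) (n : ℕ) : ℂ :=
  iteratedDeriv n f 0 / (n.factorial : ℂ)

/-- The inverse function of `f` restricted to `U`. For `f` univalent in `U` it satisfies
`f⁻¹(f(z)) = z` for `z ∈ U`, takes values in `U` on `f(U)`, and `f(f⁻¹(w)) = w` for `w ∈ f(U)`;
values outside `f(U)` play no role. -/
noncomputable def inverse (f : ℂ → ℂ) : ℂ → ℂ :=
  Function.invFunOn f unitDisk

/-- `f` is bi-univalent, with inverse considered on the disk `D_r = {w : |w| < r}`, `r ≥ 1/4`:
`f ∈ S`, the inverse is defined on `D_r` (that is, `D_r ⊆ f(U)`), and it is analytic and univalent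
there. -/
structure IsBiUnivalentOn (f : ℂ → ℂ) (r : ℝ) : Prop where
  mem_classS : f ∈ classS
  quarter_le : 1 / 4 ≤ r
  subset_image : ball (0 : ℂ) r ⊆ f '' unitDisk
  analytic_inverse : AnalyticOnNhd ℂ (inverse f) (ball (0 : ℂ) r)
  injOn_inverse : Set.InjOn (inverse f) (ball (0 : ℂ) r)

/-- Subordination `F ≺ Φ` on `D_r = {z : |z| < r}`: there is `ω` analytic on `D_r` with `ω(0) = 0`,
`|ω(z)| < 1` and `F(z) = Φ(ω(z))` on `D_r`. -/
def SubordinateOn (r : ℝ) (F Φ : ℂ → ℂ) : Prop :=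
  ∃ ω : ℂ → ℂ, AnalyticOnNhd ℂ ω (ball (0 : ℂ) r) ∧ ω 0 = 0 ∧
    ∀ z ∈ ball (0 : ℂ) r, ‖ω z‖ < 1 ∧ F z = Φ (ω z)

/-- `G(t, z) = 1 / (1 - 2 t z + z²)`, the generating function of the Chebyshev polynomials of the
second kind. -/
noncomputable def chebyshevG (t : ℝ) (z : ℂ) : ℂ :=
  1 / (1 - 2 * (t : ℂ) * z + z ^ 2)

/-- `(1 - β) f(z)/z + β f'(z)`. For `f(0) = 0`, `dslope f 0 z` is `f(z)/z` at `z ≠ 0`, and at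
`z = 0` it is the limit value `f'(0)`. -/
noncomputable def mixedDeriv (β : ℝ) (f : ℂ → ℂ) (z : ℂ) : ℂ :=
  (1 - (β : ℂ)) * dslope f 0 z + (β : ℂ) * deriv f z

/-- The class `Q_Σ(G, β, t)`. -/
def classQ (β t : ℝ) : Set (ℂ → ℂ) :=
  {f | ∃ r : ℝ, IsBiUnivalentOn f r ∧
    SubordinateOn 1 (mixedDeriv β f) (chebyshevG t) ∧
    SubordinateOn r (mixedDeriv β (inverse f)) (chebyshevG t)}

/-- The class `ℜ_Σ(G) = Q_Σ(G, 1, √2/2)`. -/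
noncomputable def classR : Set (ℂ → ℂ) :=
  classQ 1 (Real.sqrt 2 / 2)

end BiUnivalent

open scoped ComplexConjugate

/-! Write `f' = G ∘ ω` and let `c₁, c₂, c₃` be the Taylor coefficients of the Schwarz function `ω`.
Comparing coefficients in `f' * (1 - √2 ω + ω²) = 1` (`coeff_of_mul_quadratic_eq_one`) turns `a₂a₄ -
a₃²` into a polynomial in the `cᵢ`. Since `|ω| < 1`, Parseval on circles gives `|c₁|² + |c₂|² +
|c₃|² ≤ 1` (`sum_sq_coeff_le_one`). The triangle inequality and this constraint alone already give
`1/4` (`hankel_bound`). -/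

/-- Peeling off the constant Taylor coefficient: `dslope` at the origin shifts the coefficients. -/
lemma coeff_dslope {g : ℂ → ℂ} (hg : AnalyticAt ℂ g 0) (n : ℕ) :
    BiUnivalent.coeff (dslope g 0) n = BiUnivalent.coeff g (n + 1) := by
  have h := hg.hasFPowerSeriesAt.has_fpower_series_dslope_fslope
  have h' := congrArg (fun p => FormalMultilinearSeries.coeff p n)
    (h.analyticAt.hasFPowerSeriesAt.eq_formalMultilinearSeries h)
  simpa [FormalMultilinearSeries.coeff_ofScalars, BiUnivalent.coeff,
    FormalMultilinearSeries.coeff_fslope] using h'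

lemma coeff_zero (g : ℂ → ℂ) : BiUnivalent.coeff g 0 = g 0 := by
  simp [BiUnivalent.coeff]

lemma coeff_deriv (g : ℂ → ℂ) (n : ℕ) :
    BiUnivalent.coeff (deriv g) n = (n + 1) * BiUnivalent.coeff g (n + 1) := by
  have h : (n.factorial : ℂ) ≠ 0 := by exact_mod_cast n.factorial_ne_zero
  have h' : (n : ℂ) + 1 ≠ 0 := by exact_mod_cast n.succ_ne_zero
  simp only [BiUnivalent.coeff, iteratedDeriv_succ', Nat.factorial_succ]
  push_cast
  field_simp

lemma eq_add_mul_dslope (g : ℂ → ℂ) (z : ℂ) : g z = g 0 + z * dslope g 0 z := by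
  have h := sub_smul_dslope g 0 z
  simp only [sub_zero, smul_eq_mul] at h
  rw [h]; ring

lemma differentiableOn_dslope_ball {g : ℂ → ℂ} {R : ℝ} (hR : 0 < R)
    (hg : DifferentiableOn ℂ g (ball 0 R)) : DifferentiableOn ℂ (dslope g 0) (ball 0 R) :=
  (Complex.differentiableOn_dslope (ball_mem_nhds 0 hR)).2 hg

/-- A common factor `z` may be cancelled, also at the origin, by continuity. -/
lemma eqOn_of_mul_eqOn {A B : ℂ → ℂ} {R : ℝ} (hA : ContinuousOn A (ball 0 R))
    (hB : ContinuousOn B (ball 0 R)) (h : ∀ z ∈ ball (0 : ℂ) R, z * A z = z * B z) :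
    Set.EqOn A B (ball 0 R) := by
  intro z hz
  by_cases hz0 : z = 0
  · subst hz0
    have hn := isOpen_ball.mem_nhds hz
    have hA' := ((hA 0 hz).continuousAt hn).tendsto.mono_left
      (nhdsWithin_le_nhds (s := ({0} : Set ℂ)ᶜ))
    have hB' := ((hB 0 hz).continuousAt hn).tendsto.mono_left
      (nhdsWithin_le_nhds (s := ({0} : Set ℂ)ᶜ))
    refine tendsto_nhds_unique (hA'.congr' ?_) hB'
    filter_upwards [nhdsWithin_le_nhds hn, self_mem_nhdsWithin] with w hw hw0
    exact mul_left_cancel₀ hw0 (h w hw)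
  · exact mul_left_cancel₀ hz0 (h z hz)

/-- If a holomorphic function vanishes at the center of a disk, a lower bound `-a` of its real part
on a circle satisfies `0 ≤ a`. -/
lemma nonneg_of_re_le_on_circle {A : ℂ → ℂ} {r a : ℝ} (hr : 0 < r)
    (hA : DifferentiableOn ℂ A (closedBall 0 r)) (hA0 : A 0 = 0)
    (h : ∀ z ∈ sphere (0 : ℂ) r, (A z).re ≤ a) : 0 ≤ a := by
  have hr' : |r| = r := abs_of_pos hr
  have hc : CircleIntegrable A 0 r :=
    (hA.continuousOn.mono sphere_subset_closedBall).circleIntegrable hr.le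
  have hd : DiffContOnCl ℂ A (ball 0 |r|) := by
    rw [hr']
    exact DifferentiableOn.diffContOnCl (by rwa [closure_ball _ hr.ne'])
  have hmean : Real.circleAverage (Complex.reCLM ∘ A) 0 r = 0 := by
    rw [Complex.reCLM.circleAverage_comp_comm hc, hd.circleAverage, hA0, map_zero]
  rw [← hmean]
  refine Real.circleAverage_mono_on_of_le_circle ?_ (by rw [hr']; exact h)
  exact ((Complex.continuous_re.comp_continuousOn hA.continuousOn).mono
    sphere_subset_closedBall).circleIntegrable hr.le

/-- Bessel's inequality for the first three Taylor coefficients of a Schwarz function. -/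
lemma sum_sq_coeff_le_one {k : ℂ → ℂ} {c₁ c₂ c₃ : ℂ} (hk : DifferentiableOn ℂ k (ball 0 1))
    (hbound : ∀ z ∈ ball (0 : ℂ) 1, ‖z * (c₁ + z * (c₂ + z * (c₃ + z * k z)))‖ ≤ 1) :
    ‖c₁‖ ^ 2 + ‖c₂‖ ^ 2 + ‖c₃‖ ^ 2 ≤ 1 := by
  have key : ∀ r ∈ Set.Ioo (0 : ℝ) 1,
      r ^ 2 * (‖c₁‖ ^ 2 + r ^ 2 * ‖c₂‖ ^ 2 + r ^ 4 * ‖c₃‖ ^ 2) ≤ 1 := by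
    rintro r ⟨hr0, hr1⟩
    -- On `|z| = r` the cross terms of `|c₁ + c₂ z + c₃ z² + z³ k|²` equal `2 Re B`: substituting `z
    -- * conj z = r²` removes every `conj z`, so `B` is holomorphic with `B 0 = 0`, and `Re B` has
    -- mean zero on the circle.
    let B : ℂ → ℂ := fun z => conj c₁ * c₂ * z + conj c₁ * c₃ * z ^ 2 + r ^ 2 * conj c₂ * c₃ * z +
      (conj c₁ * z ^ 3 + conj c₂ * r ^ 2 * z ^ 2 + conj c₃ * r ^ 4 * z) * k z
    have hB : DifferentiableOn ℂ B (closedBall 0 r) := by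
      have := hk.mono (closedBall_subset_ball hr1)
      fun_prop
    have hle : ∀ z ∈ sphere (0 : ℂ) r, (B z).re ≤
        (1 / r ^ 2 - (‖c₁‖ ^ 2 + r ^ 2 * ‖c₂‖ ^ 2 + r ^ 4 * ‖c₃‖ ^ 2)) / 2 := by
      intro z hz
      have hzr : ‖z‖ = r := by simpa using hz
      have hzz : (r : ℂ) ^ 2 = z * conj z := by rw [Complex.mul_conj', hzr]
      set u := c₁ + z * (c₂ + z * (c₃ + z * k z)) with hu
      have hub : ‖u‖ ^ 2 ≤ 1 / r ^ 2 := by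
        have h1 := hbound z (by simpa [hzr] using hr1)
        rw [norm_mul, hzr] at h1
        rw [le_div_iff₀ (by positivity), ← mul_pow, mul_comm]
        exact pow_le_one₀ (by positivity) h1
      have hid : ((‖u‖ ^ 2 : ℝ) : ℂ) =
          ((‖c₁‖ ^ 2 + r ^ 2 * ‖c₂‖ ^ 2 + r ^ 4 * ‖c₃‖ ^ 2 + ‖z ^ 3 * k z‖ ^ 2 : ℝ) : ℂ)
            + (B z + conj (B z)) := by
        have hr4 : (r : ℂ) ^ 4 = (z * conj z) ^ 2 := by rw [← hzz]; ring
        push_cast [← Complex.mul_conj', hr4, hzz, B, hu]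
        simp only [map_add, map_mul, map_pow, Complex.conj_conj]
        ring
      have hre := congrArg Complex.re hid
      rw [Complex.add_conj, Complex.add_re, Complex.ofReal_re, Complex.ofReal_re,
        Complex.ofReal_re] at hre
      nlinarith [sq_nonneg ‖z ^ 3 * k z‖]
    have h0 := nonneg_of_re_le_on_circle hr0 hB (by simp [B]) hle
    have h1 : ‖c₁‖ ^ 2 + r ^ 2 * ‖c₂‖ ^ 2 + r ^ 4 * ‖c₃‖ ^ 2 ≤ 1 / r ^ 2 := by linarith
    rwa [le_div_iff₀ (by positivity), mul_comm] at h1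
  have hcont : Continuous fun r : ℝ =>
      r ^ 2 * (‖c₁‖ ^ 2 + r ^ 2 * ‖c₂‖ ^ 2 + r ^ 4 * ‖c₃‖ ^ 2) := by fun_prop
  have hlim := (hcont.tendsto 1).mono_left (nhdsWithin_le_nhds (s := Set.Iio 1))
  simp only [one_pow, one_mul] at hlim
  refine le_of_tendsto hlim ?_
  filter_upwards [Ioo_mem_nhdsLT (zero_lt_one' ℝ)] with r hr using key r hr

/-- The roots `t ± i √(1 - t²)` lie on the unit circle. This allows the denominator of `G ∘ ω` to be
cleared. -/
lemma one_sub_mul_add_sq_ne_zero {w : ℂ} {t : ℝ} (ht : t ^ 2 ≤ 1) (hw : ‖w‖ < 1) :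
    1 - 2 * (t : ℂ) * w + w ^ 2 ≠ 0 := by
  intro h
  set e : ℂ := t + Real.sqrt (1 - t ^ 2) * Complex.I with he
  have hs : ((Real.sqrt (1 - t ^ 2) : ℝ) : ℂ) ^ 2 = 1 - (t : ℂ) ^ 2 := by
    exact_mod_cast Real.sq_sqrt (sub_nonneg.2 ht)
  have hfac : (w - e) * (w - conj e) = 0 := by
    rw [← h, he]
    simp only [map_add, map_mul, Complex.conj_ofReal, Complex.conj_I]
    linear_combination hs * (-Complex.I ^ 2) + (1 - (t : ℂ) ^ 2) * (-Complex.I_sq)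
  have hne : ‖e‖ = 1 := by
    have h2 : ‖e‖ ^ 2 = 1 := by
      have : ((‖e‖ ^ 2 : ℝ) : ℂ) = 1 := by
        push_cast
        rw [← Complex.mul_conj', he]
        simp only [map_add, map_mul, Complex.conj_ofReal, Complex.conj_I]
        linear_combination hs * (-Complex.I ^ 2) + (1 - (t : ℂ) ^ 2) * (-Complex.I_sq)
      exact_mod_cast this
    exact (pow_eq_one_iff_of_nonneg (norm_nonneg _) two_ne_zero).1 h2
  rcases mul_eq_zero.1 hfac with h' | h'
  · rw [sub_eq_zero.1 h', hne] at hw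
    exact lt_irrefl _ hw
  · rw [sub_eq_zero.1 h', Complex.norm_conj, hne] at hw
    exact lt_irrefl _ hw

/-- The first Taylor coefficients of `1 / (1 - s ω + ω²)` in terms of those of `ω`. -/
lemma coeff_of_mul_quadratic_eq_one {F ω : ℂ → ℂ} {s : ℂ}
    (hF : DifferentiableOn ℂ F (ball 0 1)) (hω : DifferentiableOn ℂ ω (ball 0 1)) (hω0 : ω 0 = 0)
    (h : ∀ z ∈ ball (0 : ℂ) 1, F z * (1 - s * ω z + ω z ^ 2) = 1) :
    BiUnivalent.coeff F 1 = s * BiUnivalent.coeff ω 1 ∧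
    BiUnivalent.coeff F 2 = s * BiUnivalent.coeff ω 2 + (s ^ 2 - 1) * BiUnivalent.coeff ω 1 ^ 2 ∧
    BiUnivalent.coeff F 3 = s * BiUnivalent.coeff ω 3
      + 2 * (s ^ 2 - 1) * BiUnivalent.coeff ω 1 * BiUnivalent.coeff ω 2
      + (s ^ 3 - 2 * s) * BiUnivalent.coeff ω 1 ^ 3 := by
  have h0 : (0 : ℂ) ∈ ball (0 : ℂ) 1 := by simp
  have an : ∀ {g : ℂ → ℂ}, DifferentiableOn ℂ g (ball 0 1) → AnalyticAt ℂ g 0 :=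
    fun hg => hg.analyticAt (ball_mem_nhds 0 one_pos)
  have dF₁ := differentiableOn_dslope_ball one_pos hF
  have dF₂ := differentiableOn_dslope_ball one_pos dF₁
  have dF₃ := differentiableOn_dslope_ball one_pos dF₂
  have dW₁ := differentiableOn_dslope_ball one_pos hω
  have dW₂ := differentiableOn_dslope_ball one_pos dW₁
  have dW₃ := differentiableOn_dslope_ball one_pos dW₂
  have eF₀ := eq_add_mul_dslope F
  have eW₀ := eq_add_mul_dslope ω
  have eF₁ := eq_add_mul_dslope (dslope F 0)
  have eW₁ := eq_add_mul_dslope (dslope ω 0)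
  have eF₂ := eq_add_mul_dslope (dslope (dslope F 0) 0)
  have eW₂ := eq_add_mul_dslope (dslope (dslope ω 0) 0)
  rw [show BiUnivalent.coeff F 1 = dslope F 0 0 by rw [← coeff_dslope (an hF), coeff_zero],
    show BiUnivalent.coeff F 2 = dslope (dslope F 0) 0 0 by
      rw [← coeff_dslope (an hF), ← coeff_dslope (an dF₁), coeff_zero],
    show BiUnivalent.coeff F 3 = dslope (dslope (dslope F 0) 0) 0 0 by
      rw [← coeff_dslope (an hF), ← coeff_dslope (an dF₁), ← coeff_dslope (an dF₂), coeff_zero],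
    show BiUnivalent.coeff ω 1 = dslope ω 0 0 by rw [← coeff_dslope (an hω), coeff_zero],
    show BiUnivalent.coeff ω 2 = dslope (dslope ω 0) 0 0 by
      rw [← coeff_dslope (an hω), ← coeff_dslope (an dW₁), coeff_zero],
    show BiUnivalent.coeff ω 3 = dslope (dslope (dslope ω 0) 0) 0 0 by
      rw [← coeff_dslope (an hω), ← coeff_dslope (an dW₁), ← coeff_dslope (an dW₂), coeff_zero]]
  have hF0 : F 0 = 1 := by simpa [hω0] using h 0 h0
  generalize dslope (dslope (dslope F 0) 0) 0 = F₃ at *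
  generalize dslope (dslope (dslope ω 0) 0) 0 = W₃ at *
  generalize dslope (dslope F 0) 0 = F₂ at *
  generalize dslope (dslope ω 0) 0 = W₂ at *
  generalize dslope F 0 = F₁ at *
  generalize dslope ω 0 = W₁ at *
  simp only [hF0, hω0, zero_add] at eF₀ eW₀
  replace hF := hF.continuousOn
  replace hω := hω.continuousOn
  replace dF₁ := dF₁.continuousOn
  replace dF₂ := dF₂.continuousOn
  replace dF₃ := dF₃.continuousOn
  replace dW₁ := dW₁.continuousOn
  replace dW₂ := dW₂.continuousOn
  replace dW₃ := dW₃.continuousOn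
  -- Each `rᵢ` is the previous identity minus its value at the origin, divided by `z`; evaluating it
  -- at `0` gives the next coefficient.
  have r₁ : Set.EqOn (fun z => F₁ z * (1 - s * ω z + ω z ^ 2)) (fun z => s * W₁ z - z * W₁ z ^ 2)
      (ball 0 1) := by
    refine eqOn_of_mul_eqOn (by fun_prop) (by fun_prop) fun z hz => ?_
    have := h z hz
    rw [eF₀] at this
    linear_combination this + (s - ω z - z * W₁ z) * eW₀ z
  have b₁ : F₁ 0 = s * W₁ 0 := by simpa [hω0] using r₁ h0
  have r₂ : Set.EqOn (fun z => F₂ z + F₁ z * (-s * W₁ z + z * W₁ z ^ 2))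
      (fun z => s * W₂ z - W₁ z ^ 2) (ball 0 1) := by
    refine eqOn_of_mul_eqOn (by fun_prop) (by fun_prop) fun z hz => ?_
    have := r₁ hz
    simp only [eW₀ z] at this
    linear_combination this - eF₁ z + s * eW₁ z - b₁
  have b₂ : F₂ 0 - s * (F₁ 0 * W₁ 0) = s * W₂ 0 - W₁ 0 ^ 2 := by
    have := r₂ h0
    simp only [zero_mul, add_zero] at this
    linear_combination this
  -- The product difference is split as `F₁ W₁ - F₁(0) W₁(0) = (F₁ - F₁(0)) W₁ + F₁(0) (W₁ -
  -- W₁(0))`, which is `z (F₂ W₁ + F₁(0) W₂)`.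
  have r₃ : Set.EqOn (fun z => F₃ z - s * (F₂ z * W₁ z + F₁ 0 * W₂ z) + F₁ z * W₁ z ^ 2)
      (fun z => s * W₃ z - W₂ z * (W₁ z + W₁ 0)) (ball 0 1) := by
    refine eqOn_of_mul_eqOn (by fun_prop) (by fun_prop) fun z hz => ?_
    have := r₂ hz
    simp only at this
    linear_combination this - b₂ - eF₂ z + s * eW₂ z + s * W₁ z * eF₁ z + s * F₁ 0 * eW₁ z
      - (W₁ z + W₁ 0) * eW₁ z
  have b₃ := r₃ h0
  simp only at b₃
  refine ⟨b₁, ?_, ?_⟩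
  · rw [b₁] at b₂
    linear_combination b₂
  · rw [b₁] at b₂ b₃
    linear_combination b₃ + s * W₁ 0 * b₂

/-- The terms other than the mixed one `c₁² c₂` contribute at most `2/9 (|c₁|² + |c₂|² + |c₃|²) ≤
2/9`, and the mixed one at most `1/24 * 1/2`; the total is `35/144 < 1/4`. -/
lemma hankel_bound {c₁ c₂ c₃ : ℂ} (h : ‖c₁‖ ^ 2 + ‖c₂‖ ^ 2 + ‖c₃‖ ^ 2 ≤ 1) :
    ‖c₁ * c₃ / 4 + (Real.sqrt 2 / 36 : ℝ) * (c₁ ^ 2 * c₂) - 2 / 9 * c₂ ^ 2 - c₁ ^ 4 / 9‖ ≤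
      1 / 4 := by
  have hs : Real.sqrt 2 ≤ 3 / 2 := Real.sqrt_le_iff.2 ⟨by norm_num, by norm_num⟩
  have htri : ‖c₁ * c₃ / 4 + (Real.sqrt 2 / 36 : ℝ) * (c₁ ^ 2 * c₂) - 2 / 9 * c₂ ^ 2
      - c₁ ^ 4 / 9‖ ≤ ‖c₁‖ * ‖c₃‖ / 4 + Real.sqrt 2 / 36 * (‖c₁‖ ^ 2 * ‖c₂‖) + 2 / 9 * ‖c₂‖ ^ 2
      + ‖c₁‖ ^ 4 / 9 := by
    refine (norm_sub_le _ _).trans (add_le_add ((norm_sub_le _ _).trans (add_le_add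
      ((norm_add_le _ _).trans (add_le_add ?_ ?_)) ?_)) ?_)
    · simp
    · rw [norm_mul, Complex.norm_real, Real.norm_of_nonneg (by positivity)]; simp
    · simp
    · simp
  refine htri.trans ?_
  have hb := norm_nonneg c₂
  generalize ‖c₁‖ = a, ‖c₂‖ = b, ‖c₃‖ = d at *
  have ha : a ^ 2 ≤ 1 := by nlinarith [sq_nonneg b, sq_nonneg d]
  -- As `a⁴ ≤ a²`, it is enough that the quadratic form `a²/9 - ad/4 + 2d²/9` is positive definite.
  have h1 : a * d / 4 + a ^ 4 / 9 ≤ 2 / 9 * (a ^ 2 + d ^ 2) := by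
    nlinarith [sq_nonneg (9 * a - 8 * d), mul_nonneg (sq_nonneg a) (sub_nonneg.2 ha), sq_nonneg d]
  have h2 : Real.sqrt 2 / 36 * (a ^ 2 * b) ≤ 1 / 24 * (a ^ 2 * b) :=
    mul_le_mul_of_nonneg_right (by linarith) (by positivity)
  have h3 : a ^ 2 * b ≤ 1 / 2 := by nlinarith [sq_nonneg (a ^ 2 - b), sq_nonneg (b - a), sq_nonneg d]
  linarith

theorem corollary2p3 (f : ℂ → ℂ) (hf : f ∈ BiUnivalent.classR) :
    ‖BiUnivalent.coeff f 2 * BiUnivalent.coeff f 4 - BiUnivalent.coeff f 3 ^ 2‖ ≤ 1 / 4 := by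
  obtain ⟨r, hbi, ⟨ω, hω, hω0, hsub⟩, -⟩ := hf
  have hω' : DifferentiableOn ℂ ω (ball 0 1) := hω.differentiableOn
  have hF : DifferentiableOn ℂ (deriv f) (ball 0 1) := hbi.mem_classS.1.1.deriv.differentiableOn
  set s : ℂ := ((Real.sqrt 2 : ℝ) : ℂ) with hs
  have hs2 : s ^ 2 = 2 := by
    rw [hs]; exact_mod_cast Real.sq_sqrt (zero_le_two (α := ℝ))
  have hmul : ∀ z ∈ ball (0 : ℂ) 1, deriv f z * (1 - s * ω z + ω z ^ 2) = 1 := by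
    intro z hz
    obtain ⟨hlt, heq⟩ := hsub z hz
    have ht : (Real.sqrt 2 / 2) ^ 2 ≤ 1 := by
      rw [div_pow, Real.sq_sqrt zero_le_two]; norm_num
    have hne := one_sub_mul_add_sq_ne_zero ht hlt
    have hst : 2 * ((Real.sqrt 2 / 2 : ℝ) : ℂ) = s := by push_cast; ring
    simp only [BiUnivalent.mixedDeriv, BiUnivalent.chebyshevG, Complex.ofReal_one, sub_self,
      zero_mul, zero_add, one_mul] at heq
    rw [hst] at heq hne
    rw [heq, one_div, inv_mul_cancel₀ hne]
  obtain ⟨e₁, e₂, e₃⟩ := coeff_of_mul_quadratic_eq_one hF hω' hω0 hmul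
  have an : ∀ {g : ℂ → ℂ}, DifferentiableOn ℂ g (ball 0 1) → AnalyticAt ℂ g 0 :=
    fun hg => hg.analyticAt (ball_mem_nhds 0 one_pos)
  have d₁ := differentiableOn_dslope_ball one_pos hω'
  have d₂ := differentiableOn_dslope_ball one_pos d₁
  have d₃ := differentiableOn_dslope_ball one_pos d₂
  have hsum : ‖BiUnivalent.coeff ω 1‖ ^ 2 + ‖BiUnivalent.coeff ω 2‖ ^ 2
      + ‖BiUnivalent.coeff ω 3‖ ^ 2 ≤ 1 := by
    refine sum_sq_coeff_le_one (differentiableOn_dslope_ball one_pos d₃) fun z hz => ?_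
    -- The coefficients are values at `0` of iterated `dslope`s, so the nested expression folds back
    -- to `ω z`.
    rw [← coeff_dslope (an hω') 2, ← coeff_dslope (an d₁) 1, ← coeff_dslope (an d₂) 0,
      ← coeff_dslope (an hω') 1, ← coeff_dslope (an d₁) 0, ← coeff_dslope (an hω') 0,
      coeff_zero, coeff_zero, coeff_zero, ← eq_add_mul_dslope, ← eq_add_mul_dslope,
      ← eq_add_mul_dslope]
    have := eq_add_mul_dslope ω z
    rw [hω0, zero_add] at this
    rw [← this]
    exact (hsub z hz).1.le
  rw [coeff_deriv] at e₁ e₂ e₃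
  norm_num at e₁ e₂ e₃
  convert hankel_bound hsum using 2
  generalize BiUnivalent.coeff ω 1 = c₁, BiUnivalent.coeff ω 2 = c₂,
    BiUnivalent.coeff ω 3 = c₃ at *
  have a₂ : BiUnivalent.coeff f 2 = s * c₁ / 2 := by linear_combination e₁ / 2
  have a₃ : BiUnivalent.coeff f 3 = (s * c₂ + c₁ ^ 2) / 3 := by
    linear_combination e₂ / 3 + c₁ ^ 2 / 3 * hs2
  -- The `c₁³` term drops out because `s³ = 2s`.
  have a₄ : BiUnivalent.coeff f 4 = (s * c₃ + 2 * c₁ * c₂) / 4 := by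
    linear_combination e₃ / 4 + (c₁ * c₂ / 2 + s * c₁ ^ 3 / 4) * hs2
  rw [a₂, a₃, a₄]
  push_cast
  rw [← hs]
  linear_combination (c₁ * c₃ / 8 - c₂ ^ 2 / 9) * hs2
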